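/- For $p\in[0,1]$ let $G(n,p)$ be the random graph on $n$ vertices in which each edge is inserted independently with probability $p$. For a graph $G$, let $\mathcal N[G]$ be its neighborhood complex, i.e. the simplicial complex whose faces are the sets of vertices of $G$ that have a common neighbor, and let $\|\mathcal N[G]\|$ be its geometric realization. Let $p=p(n)\in[0,1]$ and let $j=j(n)$, $k=k(n)$ be nonnegative-integer-valued functions of $n$ (not necessarily monotone). If $$\binom nj\binom nk p^{jk}=o(1)\qquad (n\to\infty),$$ then, with probability tending to $1$ as $n\to\infty$, $\|\mathcal N[G(n,p)]\|$ strong deformation retracts to a simplicial complex of dimension at most $j+k-3$; that is, some strong deformation retract of $\|\mathcal N[G(n,p)]\|$ is homeomorphic to the geometric realization of a finite simplicial complex of dimension at most $j+k-3$. -/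

import Mathlib

open Filter Topology Asymptotics

/-- The neighborhood complex of a graph `G`: its faces are the nonempty finite sets of vertices
that have a common neighbor. -/
def SimpleGraph.neighborhoodComplex {V : Type*} (G : SimpleGraph V) :
    PreAbstractSimplicialComplex V where
  faces := {s | s.Nonempty ∧ ∃ w, ∀ v ∈ s, G.Adj v w}
  isRelLowerSet_faces := fun _ hs =>
    ⟨hs.1, fun _ hts ht => ⟨ht, hs.2.imp fun _ hw v hv => hw v (hts hv)⟩⟩

namespace PreAbstractSimplicialComplex

/-- The geometric realization of a simplicial complex on a finite vertex set `V`, as a subspace of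
`V → ℝ` (with the usual topology): the points given by nonnegative barycentric coordinates
with sum `1` whose support is a face. -/
def realization {V : Type*} [Fintype V] (K : PreAbstractSimplicialComplex V) : Set (V → ℝ) :=
  {x | x ∈ stdSimplex ℝ V ∧ ∃ s ∈ K.faces, ∀ v, v ∈ s ↔ x v ≠ 0}

/-- `K` has dimension at most `d`: every face has at most `d + 1` vertices. The complex without
(nonempty) faces has dimension `-1`. -/
def DimLE {V : Type*} (K : PreAbstractSimplicialComplex V) (d : ℤ) : Prop :=
  -1 ≤ d ∧ ∀ s ∈ K.faces, (s.card : ℤ) - 1 ≤ d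

end PreAbstractSimplicialComplex

/-- `A` is a strong deformation retract of `X`: the identity of `X` is homotopic, by a homotopy
that fixes every point of `A` at all times, to a map with values in `A`. -/
def IsStrongDeformationRetract {X : Type*} [TopologicalSpace X] (A : Set X) : Prop :=
  ∃ r : C(X, X), (∀ x, r x ∈ A) ∧ (ContinuousMap.id X).HomotopicRel r A

/-- The space `X` strong deformation retracts to a (finite) simplicial complex of dimension at
most `d`: some strong deformation retract of `X` is homeomorphic to the geometric realization of
such a complex. -/
def StrongDeformationRetractsToComplexOfDimLE (X : Type*) [TopologicalSpace X] (d : ℤ) : Prop :=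
  ∃ A : Set X, IsStrongDeformationRetract A ∧
    ∃ (m : ℕ) (L : PreAbstractSimplicialComplex (Fin m)),
      L.DimLE d ∧ Nonempty (A ≃ₜ L.realization)

/-- The binomial random graph `G(n, p(n))` on the vertex set `Fin n` almost always has the
property `P n`: the probability tends to `1` as `n → ∞`. -/
def AlmostAlways (p : ℕ → unitInterval) (P : ∀ n : ℕ, SimpleGraph (Fin n) → Prop) : Prop :=
  Tendsto (fun n : ℕ => SimpleGraph.binomialRandom (Fin n) (p n) {G | P n G}) atTop (𝓝 1)

/-!
Call a vertex set closed if it contains every vertex adjacent to all of its common neighbors. The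
closure of a face of the neighborhood complex is again a face, with the same common neighbors.
The complex therefore retracts onto the points `x` whose positive superlevel sets are all closed,
and these points form a copy of the order complex of the poset of closed faces.

The retraction is explicit: replacing every superlevel set of `x` by its closure gives the weights
`spread x w = min_{z ≁ w} max_{v ≁ z} x v`, visibly continuous in `x`. The operator `spread`
is idempotent, commutes with monotone reparametrizations of the values (`spread_comp`), and
does not change the common neighbors of the support (`adj_of_spread_ne_zero`). So the straight line
from `x` to the normalization of `spread x` stays in a face, and it is constant when
`spread x = x` (`isStrongDeformationRetract_closedPoints`). The fixed points are exactly the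
combinations of indicators along chains of closed faces (`exists_isChainWeight`,
`IsChainWeight.spread_layer`), and the coefficient of a closed face `F` is the continuous function
`max 0 (min_{v ∈ F} x v - max_{w ∉ F} x w)` (`IsChainWeight.gap_layer`). This gives the
homeomorphism with the realization of the order complex (`nonempty_closedPoints_homeomorph`).

Along a chain of closed faces the sizes strictly increase while the numbers of common neighbors
strictly decrease, so a chain of `j + k - 1` closed faces produces a complete bipartite subgraph
with sides `j` and `k` (`dimLE_closedFaceComplex`). By the union bound such a subgraph
exists with probability at most `(n choose j) (n choose k) p ^ (j k)`, which tends to zero.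
-/

namespace SimpleGraph

/-! ### Closed vertex sets and their order complex -/

section Closed

variable {V : Type*} (G : SimpleGraph V)

/-- A vertex set is closed if it contains every vertex adjacent to all of its common neighbors;
equivalently, it equals the set of common neighbors of its set of common neighbors. -/
def IsNbrClosed (F : Finset V) : Prop :=
  ∀ w, (∀ z, (∀ v ∈ F, G.Adj v z) → G.Adj w z) → w ∈ F

/-- The closed faces of the neighborhood complex. -/
abbrev ClosedFace : Type _ :=
  {F : Finset V // F.Nonempty ∧ (∃ z, ∀ v ∈ F, G.Adj v z) ∧ G.IsNbrClosed F}

noncomputable instance [Fintype V] : Fintype G.ClosedFace := by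
  classical exact Subtype.fintype _

/-- The order complex of the poset of closed faces, ordered by inclusion: its faces are the
nonempty finite chains. -/
def closedFaceComplex : PreAbstractSimplicialComplex G.ClosedFace where
  faces := {s | s.Nonempty ∧ ∀ E ∈ s, ∀ F ∈ s, E.1 ⊆ F.1 ∨ F.1 ⊆ E.1}
  isRelLowerSet_faces := fun _ hs =>
    ⟨hs.1, fun _ hts ht => ⟨ht, fun E hE F hF => hs.2 E (hts hE) F (hts hF)⟩⟩

/-- The graph contains a complete bipartite graph with `j` vertices on one side and `k` on the
other. The two sides are disjoint because a simple graph has no loops. -/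
def HasBiclique (j k : ℕ) : Prop :=
  ∃ A B : Finset V, A.card = j ∧ B.card = k ∧ ∀ a ∈ A, ∀ b ∈ B, G.Adj a b

variable {G}

lemma ClosedFace.exists_notMem (F : G.ClosedFace) : ∃ w, w ∉ F.1 := by
  obtain ⟨z, hz⟩ := F.2.2.1
  exact ⟨z, fun h => G.loopless.irrefl z (hz z h)⟩

lemma ClosedFace.exists_nbr {F : G.ClosedFace} {w : V} (hw : w ∉ F.1) :
    ∃ z, (∀ v ∈ F.1, G.Adj v z) ∧ ¬ G.Adj w z := by
  by_contra! h
  exact hw (F.2.2.2 w h)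

/-- A nonempty finite chain of closed faces, cut out by a predicate, has a largest element. -/
lemma exists_max_of_chain [Fintype V] {P : G.ClosedFace → Prop}
    (hP : ∀ E F, P E → P F → E.1 ⊆ F.1 ∨ F.1 ⊆ E.1) (hne : ∃ F, P F) :
    ∃ F, P F ∧ ∀ E, P E → E.1 ⊆ F.1 := by
  classical
  obtain ⟨F₀, hF₀⟩ := hne
  obtain ⟨F, hF, hmax⟩ := (Finset.univ.filter P).exists_max_image (fun F => F.1.card)
    ⟨F₀, by simpa using hF₀⟩
  have hF' : P F := by simpa using hF
  refine ⟨F, hF', fun E hE => ?_⟩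
  rcases hP E F hE hF' with h | h
  · exact h
  · exact (Finset.eq_of_subset_of_card_le h (hmax E (by simpa using hE))).ge

lemma exists_min_of_chain [Fintype V] {P : G.ClosedFace → Prop}
    (hP : ∀ E F, P E → P F → E.1 ⊆ F.1 ∨ F.1 ⊆ E.1) (hne : ∃ F, P F) :
    ∃ F, P F ∧ ∀ E, P E → F.1 ⊆ E.1 := by
  classical
  obtain ⟨F₀, hF₀⟩ := hne
  obtain ⟨F, hF, hmin⟩ := (Finset.univ.filter P).exists_min_image (fun F => F.1.card)
    ⟨F₀, by simpa using hF₀⟩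
  have hF' : P F := by simpa using hF
  refine ⟨F, hF', fun E hE => ?_⟩
  rcases hP E F hE hF' with h | h
  · exact (Finset.eq_of_subset_of_card_le h (hmin E (by simpa using hE))).ge
  · exact h

/-- Along a chain of closed sets the sizes strictly increase and the numbers of common neighbors
strictly decrease. In a chain of `j + k - 1` closed faces, at most `j - 1` have fewer than `j`
elements and at most `k - 1` have fewer than `k` common neighbors, so one of them spans a
complete bipartite graph together with its common neighbors. -/
lemma dimLE_closedFaceComplex [Fintype V] [Nonempty V] {j k : ℕ} (h : ¬ G.HasBiclique j k) :
    G.closedFaceComplex.DimLE ((j : ℤ) + k - 3) := by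
  classical
  have hbig : ∀ A B : Finset V, j ≤ A.card → k ≤ B.card → ¬ ∀ a ∈ A, ∀ b ∈ B, G.Adj a b := by
    intro A B hA hB hAB
    obtain ⟨A', hA', rfl⟩ := Finset.exists_subset_card_eq hA
    obtain ⟨B', hB', rfl⟩ := Finset.exists_subset_card_eq hB
    exact h ⟨A', B', rfl, rfl, fun a ha b hb => hAB a (hA' ha) b (hB' hb)⟩
  -- With an empty side allowed, excluding the complete bipartite graph bounds the vertex count.
  have hj : j = 0 → Fintype.card V < k := by
    rintro rfl
    by_contra! hk
    exact hbig ∅ Finset.univ (by simp) (by simpa using hk) (by simp)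
  have hk : k = 0 → Fintype.card V < j := by
    rintro rfl
    by_contra! hj
    exact hbig Finset.univ ∅ (by simpa using hj) (by simp) (by simp)
  have hV : 0 < Fintype.card V := Fintype.card_pos
  refine ⟨by omega, fun s hs => ?_⟩
  obtain ⟨-, hch⟩ := hs
  set N : G.ClosedFace → Finset V := fun F => Finset.univ.filter fun z => ∀ v ∈ F.1, G.Adj v z
    with hN
  have hmemN : ∀ F z, z ∈ N F ↔ ∀ v ∈ F.1, G.Adj v z := by simp [hN]
  have hNanti : ∀ E F : G.ClosedFace, N E ⊆ N F → F.1 ⊆ E.1 := by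
    intro E F hEF w hw
    by_contra hwE
    obtain ⟨z, hz, hwz⟩ := ClosedFace.exists_nbr hwE
    exact hwz ((hmemN F z).1 (hEF ((hmemN E z).2 hz)) w hw)
  have hNmono : ∀ E F : G.ClosedFace, F.1 ⊆ E.1 → N E ⊆ N F := by
    intro E F hEF z hz
    exact (hmemN F z).2 fun v hv => (hmemN E z).1 hz v (hEF hv)
  have hinj₁ : Set.InjOn (fun F : G.ClosedFace => F.1.card) s := by
    intro E hE F hF hEF
    refine Subtype.ext ?_
    rcases hch E hE F hF with h' | h'
    · exact Finset.eq_of_subset_of_card_le h' hEF.ge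
    · exact (Finset.eq_of_subset_of_card_le h' hEF.le).symm
  have hinj₂ : Set.InjOn (fun F => (N F).card) s := by
    intro E hE F hF hEF
    refine Subtype.ext ?_
    have hEF : (N E).card = (N F).card := hEF
    rcases hch E hE F hF with h' | h'
    · exact h'.antisymm
        (hNanti _ _ (Finset.eq_of_subset_of_card_le (hNmono _ _ h') hEF.le).ge)
    · exact Finset.Subset.antisymm
        (hNanti _ _ (Finset.eq_of_subset_of_card_le (hNmono _ _ h') hEF.ge).ge) h'
  have hpos₁ : ∀ F : G.ClosedFace, 1 ≤ F.1.card := fun F => F.2.1.card_pos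
  have hpos₂ : ∀ F, 1 ≤ (N F).card := fun F => by
    obtain ⟨z, hz⟩ := F.2.2.1
    exact Finset.card_pos.2 ⟨z, (hmemN F z).2 hz⟩
  have hsum : ∀ F, F.1.card + (N F).card ≤ Fintype.card V := fun F => by
    rw [← Finset.card_union_of_disjoint]
    · exact Finset.card_le_univ _
    · exact Finset.disjoint_left.2 fun v hv hv' => G.loopless.irrefl v ((hmemN F v).1 hv' v hv)
  have hcount : s.card ≤ (j - 1) + (k - 1) := by
    have hsub : s ⊆ s.filter (fun F => F.1.card < j) ∪ s.filter (fun F => (N F).card < k) := by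
      intro F hF
      have : ¬ (j ≤ F.1.card ∧ k ≤ (N F).card) := fun ⟨h₁, h₂⟩ =>
        hbig F.1 (N F) h₁ h₂ fun a ha b hb => (hmemN F b).1 hb a ha
      simp only [Finset.mem_union, Finset.mem_filter, hF, true_and]
      omega
    have h₁ : (s.filter (fun F => F.1.card < j)).card ≤ (Finset.Ico 1 j).card :=
      Finset.card_le_card_of_injOn (fun F => F.1.card)
        (fun F hF => by
          have := (Finset.mem_filter.1 hF).2
          simpa using ⟨F.2.1, this⟩)
        (hinj₁.mono (by intro F hF; exact (Finset.mem_filter.1 hF).1))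
    have h₂ : (s.filter (fun F => (N F).card < k)).card ≤ (Finset.Ico 1 k).card :=
      Finset.card_le_card_of_injOn (fun F => (N F).card)
        (fun F hF => Finset.mem_coe.2
          (Finset.mem_Ico.2 ⟨hpos₂ F, (Finset.mem_filter.1 hF).2⟩))
        (hinj₂.mono (by intro F hF; exact (Finset.mem_filter.1 hF).1))
    simp only [Nat.card_Ico] at h₁ h₂
    exact (Finset.card_le_card hsub).trans ((Finset.card_union_le _ _).trans (by omega))
  -- When `j = 0` or `k = 0`, the bound `card V - 1` on the length of a chain suffices.
  have hcount' : s.card ≤ Fintype.card V - 1 := by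
    have : s.card ≤ (Finset.Ico 1 (Fintype.card V)).card :=
      Finset.card_le_card_of_injOn (fun F => F.1.card)
        (fun F _ => Finset.mem_coe.2 (Finset.mem_Ico.2 ⟨hpos₁ F, by
          have h₁ := hsum F
          have h₂ := hpos₂ F
          change F.1.card < _
          omega⟩)) hinj₁
    simpa using this
  omega

end Closed

/-! ### The closure operator on vertex weights -/

section Spread

variable {V : Type*} [Fintype V] (G : SimpleGraph V)

open Classical in
/-- The closure operator on vertex weights: for every `c`, the set where `spread x ≥ c` is the
closure (the common neighbors of the common neighbors) of the set where `x ≥ c`. The minimum is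
over the non-neighbors `z` of `w`, the maximum over the non-neighbors `v` of `z`; neither range is
empty, as no vertex is a neighbor of itself. -/
noncomputable def spread (x : V → ℝ) (w : V) : ℝ :=
  (Finset.univ.filter fun z => ¬ G.Adj w z).inf' ⟨w, by simp⟩ fun z =>
    (Finset.univ.filter fun v => ¬ G.Adj v z).sup' ⟨z, by simp⟩ x

lemma continuous_spread : Continuous G.spread := by
  refine continuous_pi fun w => ?_
  unfold spread
  refine Continuous.finset_inf'_apply _ fun z _ => ?_
  exact Continuous.finset_sup'_apply _ fun v _ => continuous_apply v

variable {G} {x : V → ℝ} {w : V}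

lemma exists_spread_ge (x : V → ℝ) (w : V) :
    ∃ z, ¬ G.Adj w z ∧ ∀ v, ¬ G.Adj v z → x v ≤ G.spread x w := by
  classical
  obtain ⟨z, hz, h⟩ := Finset.exists_mem_eq_inf' (s := Finset.univ.filter fun z => ¬ G.Adj w z)
    ⟨w, by simp⟩ fun z => (Finset.univ.filter fun v => ¬ G.Adj v z).sup' ⟨z, by simp⟩ x
  refine ⟨z, by simpa using hz, fun v hv => ?_⟩
  have h' : G.spread x w = _ := h
  rw [h']
  exact Finset.le_sup' x (by simpa using hv)

lemma exists_spread_le (x : V → ℝ) {w z : V} (hz : ¬ G.Adj w z) :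
    ∃ v, ¬ G.Adj v z ∧ G.spread x w ≤ x v := by
  classical
  obtain ⟨v, hv, h⟩ := Finset.exists_mem_eq_sup' (s := Finset.univ.filter fun v => ¬ G.Adj v z)
    ⟨z, by simp⟩ x
  refine ⟨v, by simpa using hv, ?_⟩
  rw [← h]
  exact Finset.inf'_le (fun z => (Finset.univ.filter fun v => ¬ G.Adj v z).sup' ⟨z, by simp⟩ x)
    (by simpa using hz)

lemma spread_le {a : ℝ} {z : V} (hz : ¬ G.Adj w z) (h : ∀ v, ¬ G.Adj v z → x v ≤ a) :
    G.spread x w ≤ a := by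
  obtain ⟨v, hv, hle⟩ := exists_spread_le x hz
  exact hle.trans (h v hv)

lemma le_spread {a : ℝ} (h : ∀ z, ¬ G.Adj w z → ∃ v, ¬ G.Adj v z ∧ a ≤ x v) :
    a ≤ G.spread x w := by
  obtain ⟨z, hz, hge⟩ := exists_spread_ge (G := G) x w
  obtain ⟨v, hv, hle⟩ := h z hz
  exact hle.trans (hge v hv)

lemma self_le_spread (x : V → ℝ) (w : V) : x w ≤ G.spread x w :=
  le_spread fun _ hz => ⟨w, hz, le_rfl⟩

/-- Superlevel sets of `φ ∘ x` are superlevel sets of `x`, so `spread` commutes with `φ`. -/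
lemma spread_comp {φ : ℝ → ℝ} (hφ : Monotone φ) (x : V → ℝ) :
    G.spread (fun v => φ (x v)) = fun w => φ (G.spread x w) := by
  funext w
  apply le_antisymm
  · obtain ⟨z, hz, hge⟩ := exists_spread_ge (G := G) x w
    exact spread_le hz fun v hv => hφ (hge v hv)
  · refine le_spread fun z hz => ?_
    obtain ⟨v, hv, hle⟩ := exists_spread_le x hz
    exact ⟨v, hv, hφ hle⟩

lemma spread_spread (x : V → ℝ) : G.spread (G.spread x) = G.spread x := by
  funext w
  refine le_antisymm ?_ (self_le_spread _ w)
  obtain ⟨z, hz, hge⟩ := exists_spread_ge (G := G) x w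
  exact spread_le hz fun v hv => spread_le hv hge

/-- Spreading the weights preserves the common neighbors of the support. -/
lemma adj_of_spread_ne_zero (hx : ∀ v, 0 ≤ x v) {z : V} (hz : ∀ v, x v ≠ 0 → G.Adj v z)
    (hw : G.spread x w ≠ 0) : G.Adj w z := by
  by_contra h
  refine hw (le_antisymm (spread_le h fun v hv => ?_) ((hx w).trans (self_le_spread x w)))
  by_contra! hpos
  exact hv (hz v hpos.ne')

lemma isNbrClosed_support (hx : ∀ v, 0 ≤ x v) (h : G.spread x = x) {F : Finset V}
    (hF : ∀ v, v ∈ F ↔ x v ≠ 0) : G.IsNbrClosed F := by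
  intro w hw
  by_contra hwF
  have hw0 : x w = 0 := by simpa using (hF w).not.1 hwF
  obtain ⟨z, hz, hge⟩ := exists_spread_ge (G := G) x w
  rw [h, hw0] at hge
  refine hz (hw z fun v hv => ?_)
  by_contra hvz
  exact (hF v).1 hv (le_antisymm (hge v hvz) (hx v))

end Spread

/-! ### Weights layered along a chain of closed faces -/

section Layer

variable {V : Type*} [Fintype V] {G : SimpleGraph V}

open Classical in
/-- The vertex weights obtained by putting weight `s F` on each vertex of each closed face `F`. -/
noncomputable def layer (s : G.ClosedFace → ℝ) (v : V) : ℝ := ∑ F, if v ∈ F.1 then s F else 0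

lemma continuous_layer : Continuous (layer (G := G)) := by
  refine continuous_pi fun v => ?_
  refine continuous_finsetSum _ fun F _ => ?_
  split_ifs <;> fun_prop

/-- A family of weights on closed faces that is nonnegative and supported on a chain. -/
structure IsChainWeight (s : G.ClosedFace → ℝ) : Prop where
  nonneg : ∀ F, 0 ≤ s F
  chain : ∀ E F, s E ≠ 0 → s F ≠ 0 → E.1 ⊆ F.1 ∨ F.1 ⊆ E.1

variable {s : G.ClosedFace → ℝ}

lemma IsChainWeight.layer_le (hs : IsChainWeight s) {v w : V}
    (h : ∀ F, s F ≠ 0 → v ∈ F.1 → w ∈ F.1) : layer s v ≤ layer s w := by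
  refine Finset.sum_le_sum fun F _ => ?_
  have := hs.nonneg F
  by_cases h0 : s F = 0
  · simp [h0]
  · have := h F h0
    split_ifs <;> tauto

lemma layer_nonneg (hs : ∀ F, 0 ≤ s F) (v : V) : 0 ≤ layer s v :=
  Finset.sum_nonneg fun F _ => by split_ifs <;> simp [hs]

lemma exists_mem_of_layer_ne_zero {v : V} (h : layer s v ≠ 0) : ∃ F, s F ≠ 0 ∧ v ∈ F.1 := by
  obtain ⟨F, -, hF⟩ := Finset.exists_ne_zero_of_sum_ne_zero h
  exact ⟨F, by aesop⟩

lemma sum_layer (s : G.ClosedFace → ℝ) : ∑ v, layer s v = ∑ F, s F * F.1.card := by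
  classical
  unfold layer
  rw [Finset.sum_comm]
  refine Finset.sum_congr rfl fun F _ => ?_
  rw [← Finset.sum_filter, Finset.sum_const]
  simp [mul_comm]

lemma IsChainWeight.exists_nbr [Nonempty V] (hs : IsChainWeight s) :
    ∃ z, ∀ v, layer s v ≠ 0 → G.Adj v z := by
  by_cases hne : ∃ F, s F ≠ 0
  · obtain ⟨F, -, hmax⟩ := exists_max_of_chain (P := fun F => s F ≠ 0) hs.chain hne
    obtain ⟨z, hz⟩ := F.2.2.1
    refine ⟨z, fun v hv => ?_⟩
    obtain ⟨E, hE, hvE⟩ := exists_mem_of_layer_ne_zero hv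
    exact hz v (hmax E hE hvE)
  · obtain ⟨z⟩ := ‹Nonempty V›
    refine ⟨z, fun v hv => ?_⟩
    obtain ⟨E, hE, -⟩ := exists_mem_of_layer_ne_zero hv
    exact absurd ⟨E, hE⟩ hne

lemma IsChainWeight.spread_layer (hs : IsChainWeight s) : G.spread (layer s) = layer s := by
  funext w
  refine le_antisymm ?_ (self_le_spread _ w)
  by_cases hne : ∃ F, s F ≠ 0 ∧ w ∉ F.1
  · -- A common neighbor of the largest layer that misses `w` witnesses the bound.
    obtain ⟨F, ⟨-, hwF⟩, hmax⟩ := exists_max_of_chain (P := fun F => s F ≠ 0 ∧ w ∉ F.1)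
      (fun E F hE hF => hs.chain E F hE.1 hF.1) hne
    obtain ⟨z, hz, hwz⟩ := ClosedFace.exists_nbr hwF
    refine spread_le hwz fun v hv => hs.layer_le fun E hE hvE => ?_
    by_contra hwE
    exact hv (hz v (hmax E ⟨hE, hwE⟩ hvE))
  · push Not at hne
    exact spread_le (G.loopless.irrefl w) fun v _ => hs.layer_le fun E hE _ => hne E hE

open Classical in
/-- The amount by which the weights on the closed face `F` exceed those outside `F`, and zero if
they do not. -/
noncomputable def gap (x : V → ℝ) (F : G.ClosedFace) : ℝ :=
  max 0 (F.1.inf' F.2.1 x -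
    (Finset.univ.filter fun w => w ∉ F.1).sup' 
      (F.exists_notMem.imp fun w hw => by simpa using hw) x)

lemma continuous_gap (F : G.ClosedFace) : Continuous fun x : V → ℝ => gap x F := by
  unfold gap
  refine continuous_const.max (Continuous.sub ?_ ?_)
  · exact Continuous.finset_inf'_apply _ fun v _ => continuous_apply v
  · exact Continuous.finset_sup'_apply _ fun v _ => continuous_apply v

lemma gap_eq {x : V → ℝ} {F : G.ClosedFace} {a : ℝ} (ha : 0 ≤ a)
    (hle : ∃ v ∈ F.1, ∃ w ∉ F.1, x v ≤ x w + a)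
    (hge : 0 < a → ∀ v ∈ F.1, ∀ w ∉ F.1, x w + a ≤ x v) : gap x F = a := by
  classical
  apply le_antisymm
  · obtain ⟨v, hv, w, hw, h⟩ := hle
    have h₁ := Finset.inf'_le x hv
    have h₂ := Finset.le_sup' (s := Finset.univ.filter fun w => w ∉ F.1) x
      (show w ∈ _ by simpa using hw)
    refine max_le ha ?_
    linarith
  · rcases ha.eq_or_lt with rfl | hpos
    · exact le_max_left _ _
    · refine le_max_of_le_right (le_sub_iff_add_le.2 ?_)
      refine Finset.le_inf' _ _ fun v hv => ?_
      rw [← le_sub_iff_add_le']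
      refine Finset.sup'_le _ _ fun w hw => ?_
      have := hge hpos v hv w (by simpa using hw)
      linarith

/-- A layer increment `s F` is the drop of the layered weights from `F` to its complement. -/
lemma IsChainWeight.gap_layer (hs : IsChainWeight s) (F : G.ClosedFace) :
    gap (layer s) F = s F := by
  classical
  -- Two points are compared by splitting off the summand of `F`.
  have hsplit : ∀ v, layer s v = (if v ∈ F.1 then s F else 0) +
      ∑ E ∈ Finset.univ.erase F, if v ∈ E.1 then s E else 0 := fun v => by
    rw [Finset.add_sum_erase _ (fun E : G.ClosedFace => if v ∈ E.1 then s E else 0)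
      (Finset.mem_univ F)]
    unfold layer
    exact Finset.sum_congr rfl fun _ _ => by congr
  have hrest : ∀ v w, (∀ E, E ≠ F → s E ≠ 0 → v ∈ E.1 → w ∈ E.1) →
      (∑ E ∈ Finset.univ.erase F, if v ∈ E.1 then s E else 0) ≤
        ∑ E ∈ Finset.univ.erase F, if w ∈ E.1 then s E else 0 := by
    intro v w h
    refine Finset.sum_le_sum fun E hE => ?_
    have h1 := hs.nonneg E
    have h2 := h E (Finset.ne_of_mem_erase hE)
    by_cases h0 : s E = 0
    · simp [h0]
    · split_ifs <;> tauto
  refine gap_eq (hs.nonneg F) ?_ ?_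
  · by_cases hcomp : ∀ E, s E ≠ 0 → E.1 ⊆ F.1 ∨ F.1 ⊆ E.1
    · obtain ⟨v, hv, hvmax⟩ : ∃ v ∈ F.1, ∀ E, s E ≠ 0 → v ∈ E.1 → F.1 ⊆ E.1 := by
        by_cases hne : ∃ E, s E ≠ 0 ∧ ¬ F.1 ⊆ E.1
        · obtain ⟨M, ⟨hM, hFM⟩, hmax⟩ := exists_max_of_chain
            (P := fun E => s E ≠ 0 ∧ ¬ F.1 ⊆ E.1)
            (fun E E' hE hE' => hs.chain E E' hE.1 hE'.1) hne
          obtain ⟨v, hv, hvM⟩ := Finset.not_subset.1 hFM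
          exact ⟨v, hv, fun E hE hvE => by_contra fun hn => hvM (hmax E ⟨hE, hn⟩ hvE)⟩
        · push Not at hne
          obtain ⟨v, hv⟩ := F.2.1
          exact ⟨v, hv, fun E hE _ => hne E hE⟩
      obtain ⟨w, hw, hwmin⟩ : ∃ w, w ∉ F.1 ∧ ∀ E, s E ≠ 0 → ¬ E.1 ⊆ F.1 → w ∈ E.1 := by
        by_cases hne : ∃ E, s E ≠ 0 ∧ ¬ E.1 ⊆ F.1
        · obtain ⟨M, ⟨hM, hFM⟩, hmin⟩ := exists_min_of_chain
            (P := fun E => s E ≠ 0 ∧ ¬ E.1 ⊆ F.1)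
            (fun E E' hE hE' => hs.chain E E' hE.1 hE'.1) hne
          obtain ⟨w, hwM, hw⟩ := Finset.not_subset.1 hFM
          exact ⟨w, hw, fun E hE hn => hmin E ⟨hE, hn⟩ hwM⟩
        · push Not at hne
          obtain ⟨w, hw⟩ := F.exists_notMem
          exact ⟨w, hw, fun E hE hn => absurd (hne E hE) hn⟩
      refine ⟨v, hv, w, hw, ?_⟩
      rw [hsplit v, hsplit w, if_pos hv, if_neg hw]
      have := hrest v w fun E hEF hE hvE => hwmin E hE fun hsub =>
        hEF (Subtype.ext (hsub.antisymm (hvmax E hE hvE)))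
      linarith
    · push Not at hcomp
      obtain ⟨E, hE, hEF, hFE⟩ := hcomp
      obtain ⟨w, hwE, hwF⟩ := Finset.not_subset.1 hEF
      obtain ⟨v, hvF, hvE⟩ := Finset.not_subset.1 hFE
      refine ⟨v, hvF, w, hwF, ?_⟩
      have := hs.layer_le (v := v) (w := w) fun E' hE' hvE' => by
        rcases hs.chain E E' hE hE' with h | h
        · exact h hwE
        · exact absurd (h hvE') hvE
      linarith [hs.nonneg F]
  · intro hpos v hv w hw
    rw [hsplit v, hsplit w, if_pos hv, if_neg hw]
    have := hrest w v fun E _ hE hwE => by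
      rcases hs.chain E F hE hpos.ne' with h | h
      · exact absurd (h hwE) hw
      · exact h hv
    linarith

/-- Every weight fixed by `spread` is layered along a chain of closed faces: its support is
closed, and subtracting the minimal positive value on the support leaves a fixed weight with
smaller support. -/
lemma exists_isChainWeight {x : V → ℝ} (hx : ∀ v, 0 ≤ x v) (hfix : G.spread x = x)
    (hz : ∃ z, ∀ v, x v ≠ 0 → G.Adj v z) :
    ∃ s : G.ClosedFace → ℝ, IsChainWeight s ∧ layer s = x := by
  classical
  suffices H : ∀ (S : Finset V) (x : V → ℝ), (∀ v, v ∈ S ↔ x v ≠ 0) → (∀ v, 0 ≤ x v) →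
      G.spread x = x → (∃ z, ∀ v, x v ≠ 0 → G.Adj v z) →
      ∃ s : G.ClosedFace → ℝ, IsChainWeight s ∧ layer s = x from
    H (Finset.univ.filter fun v => x v ≠ 0) x (by simp) hx hfix hz
  intro S
  induction S using Finset.strongInduction with
  | H S ih =>
  intro x hS hx hfix hz
  rcases S.eq_empty_or_nonempty with rfl | hne
  · refine ⟨0, ⟨by simp, by simp⟩, ?_⟩
    funext v
    have : x v = 0 := by simpa using (hS v).not
    simp [layer, this]
  · have hclosed := isNbrClosed_support hx hfix hS
    let F : G.ClosedFace := ⟨S, hne, by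
      obtain ⟨z, hz⟩ := hz
      exact ⟨z, fun v hv => hz v ((hS v).1 hv)⟩, hclosed⟩
    obtain ⟨u, hu, hmin⟩ := S.exists_min_image x hne
    have hupos : 0 < x u := lt_of_le_of_ne (hx u) ((hS u).1 hu).symm
    -- On the values of `x`, the monotone map `φ` subtracts the minimum on the support.
    set φ : ℝ → ℝ := fun a => max (a - x u) 0 with hφ
    have hφmono : Monotone φ := fun a b hab => by simp only [hφ]; gcongr
    have hφx : ∀ v, φ (x v) = x v - if v ∈ S then x u else 0 := by
      intro v
      by_cases hv : v ∈ S
      · simp [hφ, hv, hmin v hv]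
      · have : x v = 0 := by simpa using (hS v).not.1 hv
        simp [hφ, hv, this, hupos.le]
    have hsupp : ∀ v, φ (x v) ≠ 0 → x v ≠ 0 := by
      intro v hv h0
      exact hv (by simp [hφ, h0, hupos.le])
    obtain ⟨s, hs, hsx⟩ := ih (S.filter fun v => φ (x v) ≠ 0)
      (Finset.filter_ssubset.2 ⟨u, hu, by simp [hφ]⟩) (fun v => φ (x v))
      (fun v => by
        rw [Finset.mem_filter, hS]
        exact ⟨fun h => h.2, fun h => ⟨hsupp v h, h⟩⟩)
      (fun v => le_max_right _ _)
      (by rw [spread_comp hφmono, hfix])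
      (hz.imp fun z hz v hv => hz v (hsupp v hv))
    have hmem : ∀ E : G.ClosedFace, s E ≠ 0 → ∀ v ∈ E.1, φ (x v) ≠ 0 := by
      intro E hE v hv
      rw [← congrFun hsx v]
      refine (lt_of_lt_of_le (lt_of_le_of_ne (hs.nonneg E) (Ne.symm hE)) ?_).ne'
      have := Finset.single_le_sum (f := fun E : G.ClosedFace => if v ∈ E.1 then s E else 0)
        (fun E _ => by split_ifs <;> simp [hs.nonneg]) (Finset.mem_univ E)
      simp only [if_pos hv] at this
      refine this.trans (le_of_eq ?_)
      unfold layer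
      exact Finset.sum_congr rfl fun _ _ => by congr
    have hsub : ∀ E : G.ClosedFace, s E ≠ 0 → E.1 ⊆ S := fun E hE v hv =>
      (hS v).2 (hsupp v (hmem E hE v hv))
    let s' : G.ClosedFace → ℝ := fun E => s E + if E = F then x u else 0
    have hchain : ∀ E : G.ClosedFace, s' E ≠ 0 → s E ≠ 0 ∨ E = F := by
      intro E hE
      by_contra! h
      exact hE (by simp [s', h.1, h.2])
    refine ⟨s', ⟨fun E => ?_, fun E E' hE hE' => ?_⟩, ?_⟩
    · exact add_nonneg (hs.nonneg E) (by split_ifs <;> simp [hx])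
    · rcases hchain E hE with hE | rfl
      · rcases hchain E' hE' with hE' | rfl
        · exact hs.chain E E' hE hE'
        · exact Or.inl (hsub E hE)
      · rcases hchain E' hE' with hE' | rfl
        · exact Or.inr (hsub E' hE')
        · exact Or.inl subset_rfl
    · funext v
      have h1 : layer s' v = layer s v + if v ∈ S then x u else 0 := by
        unfold layer
        have : ∀ E : G.ClosedFace, (if v ∈ E.1 then s' E else 0) =
            (if v ∈ E.1 then s E else 0) + if E = F then (if v ∈ F.1 then x u else 0) else 0 := by
          intro E
          by_cases hEF : E = F
          · rw [hEF]
            by_cases hvF : v ∈ F.1 <;> simp [s', hvF]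
          · simp [s', hEF]
        rw [Finset.sum_congr rfl fun E _ => (by convert this E), Finset.sum_add_distrib]
        simp [F]
      rw [h1, hsx]
      change φ (x v) + _ = _
      rw [hφx]
      ring

end Layer

/-! ### The deformation retraction -/

section Retraction

variable {V : Type*} [Fintype V] {G : SimpleGraph V}

lemma mem_realization_neighborhoodComplex {x : V → ℝ} :
    x ∈ G.neighborhoodComplex.realization ↔
      x ∈ stdSimplex ℝ V ∧ ∃ z, ∀ v, x v ≠ 0 → G.Adj v z := by
  classical
  refine and_congr_right fun hx => ⟨?_, ?_⟩
  · rintro ⟨s, ⟨-, z, hz⟩, hs⟩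
    exact ⟨z, fun v hv => hz v ((hs v).2 hv)⟩
  · rintro ⟨z, hz⟩
    refine ⟨Finset.univ.filter fun v => x v ≠ 0, ⟨?_, z, by simpa using hz⟩, by simp⟩
    obtain ⟨v, -, hv⟩ := Finset.exists_ne_zero_of_sum_ne_zero (hx.2.trans_ne one_ne_zero)
    exact ⟨v, by simpa using hv⟩

lemma mem_realization_closedFaceComplex {t : G.ClosedFace → ℝ} :
    t ∈ G.closedFaceComplex.realization ↔ t ∈ stdSimplex ℝ G.ClosedFace ∧ IsChainWeight t := by
  classical
  refine and_congr_right fun ht => ⟨?_, ?_⟩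
  · rintro ⟨s, ⟨-, hch⟩, hs⟩
    exact ⟨ht.1, fun E F hE hF => hch E ((hs E).2 hE) F ((hs F).2 hF)⟩
  · intro h
    refine ⟨Finset.univ.filter fun F => t F ≠ 0, ⟨?_, fun E hE F hF => ?_⟩, by simp⟩
    · obtain ⟨F, -, hF⟩ := Finset.exists_ne_zero_of_sum_ne_zero (ht.2.trans_ne one_ne_zero)
      exact ⟨F, by simpa using hF⟩
    · exact h.chain E F (by simpa using hE) (by simpa using hF)

variable (G) in
/-- The points of the realization of the neighborhood complex whose positive superlevel sets are
all closed. -/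
def closedPoints : Set G.neighborhoodComplex.realization := {x | G.spread x.1 = x.1}

lemma one_le_sum_spread {x : V → ℝ} (hx : x ∈ stdSimplex ℝ V) : 1 ≤ ∑ v, G.spread x v :=
  hx.2.symm.le.trans (Finset.sum_le_sum fun v _ => self_le_spread x v)

lemma normalized_spread_mem {x : V → ℝ} (hx : x ∈ G.neighborhoodComplex.realization) :
    (∑ v, G.spread x v)⁻¹ • G.spread x ∈ stdSimplex ℝ V := by
  have hx' := (mem_realization_neighborhoodComplex.1 hx).1
  have h1 := one_le_sum_spread (G := G) hx'
  refine ⟨fun v => ?_, ?_⟩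
  · exact mul_nonneg (by positivity) ((hx'.1 v).trans (self_le_spread x v))
  · simp only [Pi.smul_apply, smul_eq_mul, ← Finset.mul_sum]
    exact inv_mul_cancel₀ (by positivity)

/-- The support of `spread x` has the same common neighbors as the support of `x`, so the segment
from `x` to the normalized `spread x` stays inside a face. -/
lemma segment_mem_realization {x : V → ℝ} (hx : x ∈ G.neighborhoodComplex.realization) {a : ℝ}
    (ha : a ∈ unitInterval) :
    (1 - a) • x + a • (∑ v, G.spread x v)⁻¹ • G.spread x ∈
      G.neighborhoodComplex.realization := by
  obtain ⟨hx', z, hz⟩ := mem_realization_neighborhoodComplex.1 hx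
  refine mem_realization_neighborhoodComplex.2
    ⟨convex_stdSimplex ℝ V hx' (normalized_spread_mem hx) (by linarith [ha.2]) ha.1 (by ring),
      z, fun v hv => ?_⟩
  by_contra hvz
  have h1 : x v = 0 := not_imp_comm.1 (hz v) hvz
  have h2 : G.spread x v = 0 := not_imp_comm.1 (adj_of_spread_ne_zero hx'.1 hz) hvz
  exact hv (by simp [h1, h2])

lemma normalized_spread_eq_self {x : V → ℝ} (hx : x ∈ stdSimplex ℝ V) (h : G.spread x = x) :
    (∑ v, G.spread x v)⁻¹ • G.spread x = x := by
  rw [h, hx.2, inv_one, one_smul]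

lemma isStrongDeformationRetract_closedPoints : IsStrongDeformationRetract G.closedPoints := by
  have hcont : Continuous fun q : unitInterval × G.neighborhoodComplex.realization =>
      (1 - (q.1 : ℝ)) • q.2.1 +
        (q.1 : ℝ) • (∑ v, G.spread q.2.1 v)⁻¹ • G.spread q.2.1 := by
    have hsp : Continuous fun q : unitInterval × G.neighborhoodComplex.realization =>
        G.spread q.2.1 := by
      exact (continuous_spread G).comp (continuous_subtype_val.comp continuous_snd)
    have hsum : Continuous fun q : unitInterval × G.neighborhoodComplex.realization =>
        (∑ v, G.spread q.2.1 v)⁻¹ := by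
      refine Continuous.inv₀ (continuous_finsetSum _ fun v _ => (continuous_apply v).comp hsp)
        fun q => ?_
      have := one_le_sum_spread (G := G) (mem_realization_neighborhoodComplex.1 q.2.2).1
      positivity
    fun_prop
  let H : C(unitInterval × G.neighborhoodComplex.realization,
      G.neighborhoodComplex.realization) :=
    ⟨fun q => ⟨_, segment_mem_realization q.2.2 q.1.2⟩, hcont.subtype_mk _⟩
  refine ⟨H.comp (.prodMk (.const _ 1) (.id _)), fun x => ?_, ⟨⟨⟨H, fun x => ?_, fun x => rfl⟩,
    fun a x hx => ?_⟩⟩⟩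
  · have h1 := one_le_sum_spread (G := G) (mem_realization_neighborhoodComplex.1 x.2).1
    change G.spread ((1 - (1 : ℝ)) • x.1 + (1 : ℝ) • (∑ v, G.spread x.1 v)⁻¹ • G.spread x.1) =
      (1 - (1 : ℝ)) • x.1 + (1 : ℝ) • (∑ v, G.spread x.1 v)⁻¹ • G.spread x.1
    rw [sub_self, zero_smul, zero_add, one_smul]
    have hmono : Monotone fun a : ℝ => (∑ v, G.spread x.1 v)⁻¹ * a := fun a b hab =>
      mul_le_mul_of_nonneg_left hab (by positivity)
    refine (spread_comp hmono (G.spread x.1)).trans ?_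
    rw [spread_spread]
    rfl
  · exact Subtype.ext (by simp [H])
  · refine Subtype.ext ?_
    change (1 - (a : ℝ)) • x.1 + (a : ℝ) • (∑ v, G.spread x.1 v)⁻¹ • G.spread x.1 = x.1
    rw [normalized_spread_eq_self (mem_realization_neighborhoodComplex.1 x.2).1 hx, ← add_smul]
    simp

/-- The realization of the order complex of closed faces, mapped into the realization of the
neighborhood complex by sending each closed face to its barycenter, is the set of closed points;
the inverse reads the coordinate of `F` off the gap of the weights at `F`. -/
lemma nonempty_closedPoints_homeomorph [Nonempty V] :
    Nonempty (G.closedPoints ≃ₜ G.closedFaceComplex.realization) := by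
  have hcard : ∀ F : G.ClosedFace, (0 : ℝ) < F.1.card := fun F => by
    exact_mod_cast F.2.1.card_pos
  let f : (G.ClosedFace → ℝ) → V → ℝ := fun t => layer fun F => t F / F.1.card
  let g : (V → ℝ) → G.ClosedFace → ℝ := fun x F => F.1.card * gap x F
  have hf : Continuous f := continuous_layer.comp (by fun_prop)
  have hg : Continuous g := continuous_pi fun F => continuous_const.mul (continuous_gap F)
  have hdiv : ∀ t : G.ClosedFace → ℝ, IsChainWeight t →
      IsChainWeight fun F => t F / F.1.card := fun t ht =>
    ⟨fun F => div_nonneg (ht.nonneg F) (hcard F).le, fun E F hE hF =>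
      ht.chain E F (fun h => hE (by simp [h])) (fun h => hF (by simp [h]))⟩
  have hfmem : ∀ t ∈ G.closedFaceComplex.realization,
      f t ∈ G.neighborhoodComplex.realization ∧ G.spread (f t) = f t := by
    intro t ht
    obtain ⟨hts, htc⟩ := mem_realization_closedFaceComplex.1 ht
    refine ⟨mem_realization_neighborhoodComplex.2 ⟨⟨layer_nonneg (hdiv t htc).nonneg, ?_⟩,
      (hdiv t htc).exists_nbr⟩, (hdiv t htc).spread_layer⟩
    rw [sum_layer, ← hts.2]
    exact Finset.sum_congr rfl fun F _ => div_mul_cancel₀ _ (hcard F).ne'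
  have hgf : ∀ t ∈ G.closedFaceComplex.realization, g (f t) = t := by
    intro t ht
    obtain ⟨-, htc⟩ := mem_realization_closedFaceComplex.1 ht
    funext F
    change F.1.card * gap (layer _) F = t F
    rw [(hdiv t htc).gap_layer]
    exact mul_div_cancel₀ _ (hcard F).ne'
  have hsurj : ∀ x ∈ G.neighborhoodComplex.realization, G.spread x = x →
      ∃ t ∈ G.closedFaceComplex.realization, f t = x := by
    intro x hx hfix
    obtain ⟨hxs, hz⟩ := mem_realization_neighborhoodComplex.1 hx
    obtain ⟨s, hs, rfl⟩ := exists_isChainWeight hxs.1 hfix hz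
    refine ⟨fun F => s F * F.1.card, mem_realization_closedFaceComplex.2 ⟨⟨fun F => ?_, ?_⟩,
      fun F => ?_, fun E F hE hF => ?_⟩, ?_⟩
    · exact mul_nonneg (hs.nonneg F) (hcard F).le
    · rw [← sum_layer, hxs.2]
    · exact mul_nonneg (hs.nonneg F) (hcard F).le
    · exact hs.chain E F (left_ne_zero_of_mul hE) (left_ne_zero_of_mul hF)
    · exact congrArg layer (funext fun F => mul_div_cancel_right₀ _ (hcard F).ne')
  have hgmem : ∀ x : G.closedPoints, g x.1.1 ∈ G.closedFaceComplex.realization ∧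
      f (g x.1.1) = x.1.1 := by
    intro x
    obtain ⟨t, ht, hx⟩ := hsurj x.1.1 x.1.2 x.2
    rw [← hx, hgf t ht]
    exact ⟨ht, rfl⟩
  exact ⟨{
    toFun := fun x => ⟨g x.1.1, (hgmem x).1⟩
    invFun := fun t => ⟨⟨f t.1, (hfmem t.1 t.2).1⟩, (hfmem t.1 t.2).2⟩
    left_inv := fun x => Subtype.ext (Subtype.ext (hgmem x).2)
    right_inv := fun t => Subtype.ext (hgf t.1 t.2)
    continuous_toFun := by
      exact (hg.comp (continuous_subtype_val.comp continuous_subtype_val)).subtype_mk _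
    continuous_invFun := by
      exact ((hf.comp continuous_subtype_val).subtype_mk _).subtype_mk _ }⟩

end Retraction
end SimpleGraph

/-- A finite simplicial complex can be relabelled to have vertex type `Fin m`. -/
lemma PreAbstractSimplicialComplex.exists_fin {W : Type*} [Fintype W]
    (K : PreAbstractSimplicialComplex W) {d : ℤ} (hd : K.DimLE d) :
    ∃ (m : ℕ) (L : PreAbstractSimplicialComplex (Fin m)),
      L.DimLE d ∧ Nonempty (K.realization ≃ₜ L.realization) := by
  classical
  let e := Fintype.equivFin W
  refine ⟨Fintype.card W,
    { faces := {s | s.map e.symm.toEmbedding ∈ K.faces}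
      isRelLowerSet_faces := fun s hs => ⟨by simpa using (K.isRelLowerSet_faces hs).1,
        fun t hts ht => (K.isRelLowerSet_faces hs).2 (Finset.map_subset_map.2 hts)
          (by simpa using ht)⟩ }, ⟨hd.1, fun s hs => by simpa using hd.2 _ hs⟩, ?_⟩
  refine ⟨(Homeomorph.piCongrLeft (Y := fun _ => ℝ) e).subtype fun x => ?_⟩
  have hx : ∀ i, Homeomorph.piCongrLeft (Y := fun _ => ℝ) e x i = x (e.symm i) := fun i => by
    obtain ⟨w, rfl⟩ := e.surjective i
    rw [e.symm_apply_apply]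
    exact Equiv.piCongrLeft_apply_apply (fun _ => ℝ) e x w
  change x ∈ stdSimplex ℝ W ∧ _ ↔ Homeomorph.piCongrLeft (Y := fun _ => ℝ) e x ∈ stdSimplex ℝ _ ∧ _
  refine and_congr (and_congr ?_ ?_) ⟨?_, ?_⟩
  · simp only [hx]
    exact (e.symm.forall_congr_right (q := fun w => 0 ≤ x w)).symm
  · simp only [hx]
    rw [Equiv.sum_comp e.symm x]
  · rintro ⟨s, hs, h⟩
    refine ⟨s.map e.toEmbedding, ?_, fun i => ?_⟩
    · change (s.map e.toEmbedding).map e.symm.toEmbedding ∈ K.faces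
      rw [Finset.map_map]
      simpa [← Equiv.trans_toEmbedding] using hs
    · rw [hx, ← h]
      simp [Finset.mem_map_equiv]
  · rintro ⟨s, hs, h⟩
    refine ⟨_, hs, fun w => ?_⟩
    rw [Finset.mem_map_equiv, h, hx]
    simp

namespace SimpleGraph

/-- The deterministic part: without a complete bipartite subgraph with sides `j` and `k`, the
neighborhood complex retracts to a realization of the order complex of its closed faces. -/
lemma strongDeformationRetracts_of_not_hasBiclique {V : Type*} [Fintype V] [Nonempty V]
    {G : SimpleGraph V} {j k : ℕ} (h : ¬ G.HasBiclique j k) :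
    StrongDeformationRetractsToComplexOfDimLE G.neighborhoodComplex.realization
      ((j : ℤ) + k - 3) := by
  obtain ⟨m, L, hL, ⟨e⟩⟩ := G.closedFaceComplex.exists_fin (dimLE_closedFaceComplex h)
  obtain ⟨e'⟩ := nonempty_closedPoints_homeomorph (G := G)
  exact ⟨G.closedPoints, isStrongDeformationRetract_closedPoints, m, L, hL, ⟨e'.trans e⟩⟩

/-! ### Complete bipartite subgraphs of the binomial random graph -/

section Random

open MeasureTheory unitInterval

variable {V : Type*} [Fintype V] (p : unitInterval)

/-- The edges in `T` are all present with probability at most `p ^ T.card`; this is not an equality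
when `T` contains loops. -/
lemma binomialRandom_edges_le (T : Finset (Sym2 V)) :
    binomialRandom V p {G | ∀ e ∈ T, e ∈ G.edgeSet} ≤ (toNNReal p : ENNReal) ^ T.card := by
  classical
  rw [binomialRandom_apply]
  refine (measure_mono (t := Set.pi T fun _ => {True}) ?_).trans ?_
  · rintro _ ⟨G, hG, rfl⟩ e he
    simpa using hG e he
  · rw [Measure.infinitePi_pi _ (fun _ _ => MeasurableSet.of_discrete)]
    refine (Finset.prod_le_pow_card _ _ (toNNReal p : ENNReal) fun e _ => ?_)
    have h0 : Measure.dirac False ({True} : Set Prop) = 0 := by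
      rw [Measure.dirac_apply' _ MeasurableSet.of_discrete, Set.indicator_of_notMem (by simp)]
    rw [Measure.add_apply, Measure.coe_nnreal_smul_apply, Measure.coe_nnreal_smul_apply, h0,
      mul_zero, add_zero]
    exact mul_le_of_le_one_right' prob_le_one

/-- The union bound over the pairs of sides. -/
lemma binomialRandom_hasBiclique_le (j k : ℕ) :
    binomialRandom V p {G | G.HasBiclique j k} ≤
      ((Fintype.card V).choose j : ENNReal) * (Fintype.card V).choose k *
        (toNNReal p : ENNReal) ^ (j * k) := by
  classical
  let Q := (Finset.univ : Finset V).powersetCard j ×ˢ (Finset.univ : Finset V).powersetCard k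
  have hsub : {G : SimpleGraph V | G.HasBiclique j k} ⊆
      ⋃ q ∈ Q, {G | ∀ a ∈ q.1, ∀ b ∈ q.2, G.Adj a b} := by
    rintro G ⟨A, B, hA, hB, hG⟩
    simp only [Set.mem_iUnion]
    exact ⟨(A, B), by simp [Q, hA, hB], hG⟩
  have hbound : ∀ q ∈ Q, binomialRandom V p {G | ∀ a ∈ q.1, ∀ b ∈ q.2, G.Adj a b} ≤
      (toNNReal p : ENNReal) ^ (j * k) := by
    rintro ⟨A, B⟩ hq
    simp only [Q, Finset.mem_product, Finset.mem_powersetCard_univ] at hq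
    obtain ⟨rfl, rfl⟩ := hq
    by_cases hdisj : Disjoint A B
    · have hT : ((A ×ˢ B).image fun q => s(q.1, q.2)).card = A.card * B.card := by
        rw [Finset.card_image_of_injOn, Finset.card_product]
        rintro ⟨a, b⟩ h ⟨a', b'⟩ h' hab
        simp only [Finset.coe_product, Set.mem_prod, Finset.mem_coe] at h h'
        rcases Sym2.eq_iff.1 hab with ⟨h1, h2⟩ | ⟨h1, h2⟩
        · exact Prod.ext h1 h2
        · have h1 : a = b' := h1
          exact absurd h'.2 (Finset.disjoint_left.1 hdisj (h1 ▸ h.1))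
      rw [← hT]
      refine (measure_mono ?_).trans (binomialRandom_edges_le p _)
      intro G hG e he
      obtain ⟨⟨a, b⟩, hab, rfl⟩ := Finset.mem_image.1 he
      exact hG a (Finset.mem_product.1 hab).1 b (Finset.mem_product.1 hab).2
    -- Overlapping sides would force a loop.
    · obtain ⟨v, hvA, hvB⟩ := Finset.not_disjoint_iff.1 hdisj
      have : {G : SimpleGraph V | ∀ a ∈ A, ∀ b ∈ B, G.Adj a b} = ∅ :=
        Set.eq_empty_of_forall_notMem fun G hG => G.loopless.irrefl v (hG v hvA v hvB)
      simp [this]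
  refine (measure_mono hsub).trans ((measure_biUnion_finset_le _ _).trans
    ((Finset.sum_le_sum hbound).trans (le_of_eq ?_)))
  rw [Finset.sum_const, nsmul_eq_mul]
  simp [Q]

end Random
end SimpleGraph

theorem theorem2 (p : ℕ → unitInterval) (j k : ℕ → ℕ)
    (h : (fun n : ℕ => (n.choose (j n) : ℝ) * (n.choose (k n) : ℝ) * (p n : ℝ) ^ (j n * k n))
      =o[atTop] (fun _ : ℕ => (1 : ℝ))) :
    AlmostAlways p (fun n G =>
      StrongDeformationRetractsToComplexOfDimLE G.neighborhoodComplex.realization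
        ((j n : ℤ) + (k n : ℤ) - 3)) := by
  rw [isLittleO_one_iff] at h
  have h0 := ENNReal.tendsto_ofReal h
  rw [ENNReal.ofReal_zero] at h0
  have h1 := ENNReal.Tendsto.sub (tendsto_const_nhds (x := (1 : ENNReal))) h0
    (Or.inl ENNReal.one_ne_top)
  rw [tsub_zero] at h1
  refine tendsto_of_tendsto_of_tendsto_of_le_of_le' h1 tendsto_const_nhds ?_
    (Eventually.of_forall fun n => MeasureTheory.prob_le_one)
  filter_upwards [eventually_gt_atTop 0] with n hn
  have : Nonempty (Fin n) := ⟨⟨0, hn⟩⟩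
  rw [tsub_le_iff_left]
  have hbad := SimpleGraph.binomialRandom_hasBiclique_le (V := Fin n) (p n) (j n) (k n)
  have hofReal : ENNReal.ofReal ((n.choose (j n) : ℝ) * (n.choose (k n) : ℝ) *
      (p n : ℝ) ^ (j n * k n)) = ((Fintype.card (Fin n)).choose (j n) : ENNReal) *
        (Fintype.card (Fin n)).choose (k n) *
          (unitInterval.toNNReal (p n) : ENNReal) ^ (j n * k n) := by
    rw [ENNReal.ofReal_mul (by positivity), ENNReal.ofReal_mul (by positivity),
      ENNReal.ofReal_pow (p n).2.1, Fintype.card_fin, ENNReal.ofReal_natCast,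
      ENNReal.ofReal_natCast]
    congr 2
    exact ENNReal.ofReal_eq_coe_nnreal (p n).2.1
  rw [hofReal]
  -- A union bound covers the whole space, so no measurability is needed.
  rw [← MeasureTheory.measure_univ (μ := SimpleGraph.binomialRandom (Fin n) (p n))]
  refine (MeasureTheory.measure_mono (t := {G | G.HasBiclique (j n) (k n)} ∪ _) ?_).trans
    ((MeasureTheory.measure_union_le _ _).trans (add_le_add_left hbad _))
  intro G _
  by_cases hG : G.HasBiclique (j n) (k n)
  · exact Or.inl hG
  · exact Or.inr (SimpleGraph.strongDeformationRetracts_of_not_hasBiclique hG)
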